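/- Let $(W,R)$ be a Coxeter system, with $m_{rs}\in\{1,2,3,\dots\}\cup\{\infty\}$ the order of $rs$ for $r,s\in R$, and let $\Gamma$ be its Coxeter graph: the vertex set is $R$, and distinct $r,s\in R$ are joined by an edge labelled $m_{rs}$ whenever $m_{rs}\ge 3$. Suppose that $\Gamma$ is connected ($R$ may be infinite). Let $U(\Gamma)\in\mathbb{N}\cup\{\infty\}$ be the number of elements of $W$ that have a unique reduced expression, that is, a unique expression of minimal length as a word in $R$. (1) If $\Gamma$ is a finite tree with $n$ vertices in which every edge label is $3$, then $U(\Gamma)=n^2+1$. (2) Suppose that $\Gamma$ is a finite tree with $n$ vertices in which no edge is labelled $\infty$ and exactly one edge has a label $m$ greater than $3$. Let $a$ and $b$ be the numbers of vertices of the two connected components obtained by removing this edge (so $a+b=n$). Then $U(\Gamma)=\tfrac12 mn^2+1-2ab$ if $m$ is even, and $U(\Gamma)=\tfrac12(m-1)n^2+1$ if $m$ is odd. (3) If $\Gamma$ is any other connected Coxeter graph, finite or infinite, then $U(\Gamma)=\infty$. -/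

import Mathlib

namespace CoxeterMatrix

variable {B : Type*} (M : CoxeterMatrix B)

/-- The label `m_{rs}` as an extended natural number. Mathlib encodes `m_{rs} = ∞` by the
matrix entry `0`. -/
noncomputable def edgeLabel (r s : B) : ℕ∞ :=
  if M r s = 0 then ⊤ else (M r s : ℕ∞)

/-- The underlying graph of the Coxeter graph: distinct `r, s` are joined by an edge
whenever `m_{rs} ≥ 3` (including `m_{rs} = ∞`). -/
def coxeterGraph : SimpleGraph B where
  Adj r s := r ≠ s ∧ 3 ≤ M.edgeLabel r s
  symm := ⟨fun r s h => ⟨h.1.symm, by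
    have h2 := h.2
    unfold edgeLabel at h2 ⊢
    rwa [M.symmetric s r]⟩⟩
  loopless := ⟨fun _ h => h.1 rfl⟩

/-- Every edge of the Coxeter graph has label `3`. -/
def SimplyLaced : Prop :=
  ∀ r s : B, M.coxeterGraph.Adj r s → M.edgeLabel r s = 3

/-- No edge of the Coxeter graph has label `∞`. -/
def NoInfiniteBonds : Prop :=
  ∀ r s : B, M.coxeterGraph.Adj r s → M.edgeLabel r s ≠ ⊤

/-- The set of edges of the Coxeter graph whose label is greater than `3`. -/
def heavyEdges : Set (Sym2 B) :=
  {e | ∃ r s : B, e = s(r, s) ∧ M.coxeterGraph.Adj r s ∧ 3 < M.edgeLabel r s}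

/-- The number of vertices of the part that contains `r` when the edge joining `r` and `s` is
removed from the Coxeter graph. -/
noncomputable def partSize (r s : B) : ℕ :=
  ((M.coxeterGraph.deleteEdges {s(r, s)}).connectedComponentMk r).supp.ncard

end CoxeterMatrix

/-- The number, in `ℕ ∪ {∞}`, of elements of `W` that have a unique reduced expression. -/
noncomputable def CoxeterSystem.numUniqueReduced {B W : Type*} [Group W] {M : CoxeterMatrix B}
    (cs : CoxeterSystem M W) : ℕ∞ :=
  {w : W | ∃! ω : List B, cs.IsReduced ω ∧ cs.wordProd ω = w}.encard

/-!
A braid free word is a word in the generators to which neither a cancellation `i i` nor a braid move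
can be applied: it has no equal consecutive letters and no alternating factor of length `M i j`.
An element has a unique reduced expression exactly when some (hence its only) reduced expression is
braid free, so that the theorem becomes a count of braid free words
(`CoxeterSystem.numUniqueReduced_eq_encard_isBraidFree`).

That a braid free word is reduced and unique is an instance of Tits' solution of the word problem,
and is derived from the geometric representation. A simple root is sent to a nonnegative combination
of simple roots by `w` unless it belongs to a right descent of `w`
(`geomRep_nonneg_of_not_isRightDescent`). Hence an element with two right descents `i ≠ j` has a
reduced expression that ends with the alternating word of length `M i j`
(`exists_eq_mul_alternatingWord_of_isRightDescent`), and induction on the length of the word shows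
that a braid free word has only one possible last letter, and then only one reduced form.

A nonempty braid free word is a walk in the Coxeter graph. It turns back only on edges of label at
least `4`, and for a label `m` it alternates on the edge for at most `m - 1` letters. In a finite
tree with a single edge `r s` whose label may exceed `3`, such a walk is determined by its ends `u`
and `v` and by the number `j` of times it crosses `r s`: it is the path from `u` to the near end of
`r s`, then the `j` crossings, then the path to `v`, or simply the path from `u` to `v` if `j = 0`
(`IsTree.crossWord`). The only constraints are `j ≤ m - 2` and the parity of `j`, which is even
exactly when `u` and `v` are on the same side of `r s`. With sides of `a` and `b` vertices this gives
`(a² + b²) ⌊m / 2⌋ + 2 a b ⌊(m - 1) / 2⌋` nonempty words, and the case `m = 3` is the simply laced one.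

In all other cases there are infinitely many braid free words: single letters if the graph is
infinite, walks that run around a cycle, that alternate on an edge of label `∞`, or that go back and
forth on a path whose first and last edges both have a label greater than `3`.
-/

/-! ### The geometric representation -/

open Real in
/-- Twice the cosine of `π / m`, with the value `2` for `m = 0` (which encodes `m = ∞`). -/
noncomputable def CoxeterMatrix.bondCoeff (m : ℕ) : ℝ := if m = 0 then 2 else 2 * cos (π / m)

open Real in
/-- The coefficients `sin (n π / m) / sin (π / m)` of the roots of the dihedral group of order `2m`
on its simple roots, with the limit value `n` for `m = 0` (which encodes `m = ∞`). -/
noncomputable def CoxeterMatrix.dihedralCoeff (m n : ℕ) : ℝ :=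
  if m = 0 then n else sin (n * (π / m)) / sin (π / m)

namespace CoxeterMatrix

lemma sin_pi_div_pos {m : ℕ} (hm : 2 ≤ m) : 0 < Real.sin (Real.pi / m) := by
  have h2 : (2 : ℝ) ≤ m := by exact_mod_cast hm
  apply Real.sin_pos_of_pos_of_lt_pi
  · have := Real.pi_pos
    positivity
  · rw [div_lt_iff₀ (by linarith)]
    nlinarith [Real.pi_pos]

@[simp] lemma dihedralCoeff_zero (m : ℕ) : dihedralCoeff m 0 = 0 := by
  simp [dihedralCoeff]

lemma dihedralCoeff_one {m : ℕ} (hm : m ≠ 1) : dihedralCoeff m 1 = 1 := by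
  unfold dihedralCoeff
  split_ifs with h
  · simp
  · have := (sin_pi_div_pos (m := m) (by omega)).ne'
    simp [this]

lemma dihedralCoeff_add_two (m n : ℕ) :
    dihedralCoeff m (n + 2) = bondCoeff m * dihedralCoeff m (n + 1) - dihedralCoeff m n := by
  unfold dihedralCoeff bondCoeff
  split_ifs with h
  · push_cast; ring
  · rw [← mul_div_assoc (2 * Real.cos _), ← sub_div]
    congr 1
    set θ := Real.pi / m
    have h1 : ((n + 2 : ℕ) : ℝ) * θ = ((n + 1 : ℕ) : ℝ) * θ + θ := by push_cast; ring
    have h2 : (n : ℝ) * θ = ((n + 1 : ℕ) : ℝ) * θ - θ := by push_cast; ring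
    rw [h1, h2, Real.sin_add, Real.sin_sub]
    ring

lemma dihedralCoeff_nonneg {m n : ℕ} (hm : m ≠ 1) (hn : m ≠ 0 → n ≤ m) :
    0 ≤ dihedralCoeff m n := by
  unfold dihedralCoeff
  split_ifs with h
  · positivity
  · have hm' : (0 : ℝ) < m := by exact_mod_cast Nat.pos_of_ne_zero h
    have hn' : (n : ℝ) ≤ m := by exact_mod_cast hn h
    refine div_nonneg (Real.sin_nonneg_of_nonneg_of_le_pi ?_ ?_) (sin_pi_div_pos (by omega)).le
    · have := Real.pi_pos
      positivity
    · rw [← mul_div_assoc, div_le_iff₀ hm']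
      nlinarith [Real.pi_pos]

lemma dihedralCoeff_two_mul_self (m : ℕ) : dihedralCoeff m (2 * m) = 0 := by
  unfold dihedralCoeff
  split_ifs with h
  · simp [h]
  · have hm' : (m : ℝ) ≠ 0 := by exact_mod_cast h
    have : ((2 * m : ℕ) : ℝ) * (Real.pi / m) = 2 * Real.pi := by push_cast; field_simp
    rw [this]; simp

lemma dihedralCoeff_two_mul_self_add_one {m : ℕ} (hm : m ≠ 1) :
    dihedralCoeff m (2 * m + 1) = 1 := by
  unfold dihedralCoeff
  split_ifs with h
  · simp [h]
  · have hm' : (m : ℝ) ≠ 0 := by exact_mod_cast h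
    have : ((2 * m + 1 : ℕ) : ℝ) * (Real.pi / m) = Real.pi / m + 2 * Real.pi := by
      push_cast; field_simp; ring
    rw [this, Real.sin_add_two_pi, div_self (sin_pi_div_pos (by omega)).ne']

variable {B : Type*} (M : CoxeterMatrix B)

/-- The functional `2⟨α i, ·⟩` of the Tits form on the space with basis the simple
roots `α i = Finsupp.single i 1`. -/
noncomputable def coroot (i : B) : (B →₀ ℝ) →ₗ[ℝ] ℝ :=
  Finsupp.linearCombination ℝ fun j => -bondCoeff (M i j)

/-- The reflection in the simple root `α i` of the geometric representation. -/
noncomputable def geomReflection (i : B) : Module.End ℝ (B →₀ ℝ) :=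
  1 - (M.coroot i).smulRight (Finsupp.single i 1)

lemma geomReflection_apply (i : B) (v : B →₀ ℝ) :
    M.geomReflection i v = v - M.coroot i v • Finsupp.single i 1 := by
  simp [geomReflection]

lemma coroot_single (i j : B) : M.coroot i (Finsupp.single j 1) = -bondCoeff (M i j) := by
  simp [coroot, Finsupp.linearCombination_single]

lemma bondCoeff_diag (i : B) : bondCoeff (M i i) = -2 := by
  simp [bondCoeff]

lemma geomReflection_single_self (i : B) :
    M.geomReflection i (Finsupp.single i 1) = -Finsupp.single i 1 := by
  rw [geomReflection_apply, coroot_single, bondCoeff_diag]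
  module

lemma geomReflection_comb (i j : B) (x y : ℝ) :
    M.geomReflection i (x • Finsupp.single i 1 + y • Finsupp.single j 1) =
      (bondCoeff (M i j) * y - x) • Finsupp.single i 1 + y • Finsupp.single j 1 := by
  rw [geomReflection_apply, map_add, map_smul, map_smul, coroot_single, coroot_single,
    bondCoeff_diag, smul_eq_mul, smul_eq_mul]
  module

lemma geomReflection_mul_self (i : B) : M.geomReflection i * M.geomReflection i = 1 := by
  refine LinearMap.ext fun v => ?_
  rw [Module.End.mul_apply, Module.End.one_apply, geomReflection_apply M i v, map_sub, map_smul,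
    geomReflection_single_self, geomReflection_apply]
  module

lemma geomReflection_mul_comb (i j : B) (x y : ℝ) :
    (M.geomReflection i * M.geomReflection j)
        (x • Finsupp.single i 1 + y • Finsupp.single j 1) =
      (bondCoeff (M i j) * (bondCoeff (M i j) * x - y) - x) • Finsupp.single i 1 +
        (bondCoeff (M i j) * x - y) • Finsupp.single j 1 := by
  rw [Module.End.mul_apply, add_comm, geomReflection_comb, M.symmetric j i, add_comm,
    geomReflection_comb]

/-- The powers of a product of two simple reflections act on the plane of their roots through the
dihedral coefficients. -/
lemma geomReflection_mul_pow_comb {i j : B} (hij : i ≠ j) (n : ℕ) (x y : ℝ) :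
    ((M.geomReflection i * M.geomReflection j) ^ n)
        (x • Finsupp.single i 1 + y • Finsupp.single j 1) =
      (x * dihedralCoeff (M i j) (2 * n + 1) - y * dihedralCoeff (M i j) (2 * n)) •
          Finsupp.single i 1 +
        (x * dihedralCoeff (M i j) (2 * n) + y * (dihedralCoeff (M i j) (2 * n + 1)
          - bondCoeff (M i j) * dihedralCoeff (M i j) (2 * n))) • Finsupp.single j 1 := by
  induction n with
  | zero => simp [dihedralCoeff_one (M.off_diagonal i j hij)]
  | succ n ih =>
    have e1 : dihedralCoeff (M i j) (2 * (n + 1)) = _ := dihedralCoeff_add_two (M i j) (2 * n)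
    have e2 : dihedralCoeff (M i j) (2 * (n + 1) + 1) = _ :=
      dihedralCoeff_add_two (M i j) (2 * n + 1)
    have e3 : 2 * n + 1 + 1 = 2 * (n + 1) := by ring
    rw [e3, e1] at e2
    rw [pow_succ', Module.End.mul_apply, ih, geomReflection_mul_comb, e1, e2]
    congr 2 <;> ring

theorem isLiftable_geomReflection : M.IsLiftable M.geomReflection := by
  intro i j
  by_cases hij : i = j
  · subst hij
    simp [geomReflection_mul_self]
  by_cases h0 : M i j = 0
  · simp [h0]
  have h1 := M.off_diagonal i j hij
  refine LinearMap.ext fun v => ?_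
  set m := M i j with hm
  set p := bondCoeff m with hp
  have hp4 : 4 - p ^ 2 ≠ 0 := by
    have hs := sin_pi_div_pos (m := m) (by omega)
    have : 4 - p ^ 2 = 4 * Real.sin (Real.pi / m) ^ 2 := by
      rw [hp, bondCoeff, if_neg h0, Real.sin_sq]; ring
    rw [this]; positivity
  -- Split `v` into its part in the plane of `α i` and `α j` and a part fixed by both reflections.
  set x := (2 * M.coroot i v + p * M.coroot j v) / (4 - p ^ 2) with hx
  set y := (p * M.coroot i v + 2 * M.coroot j v) / (4 - p ^ 2) with hy
  set c : B →₀ ℝ := x • Finsupp.single i 1 + y • Finsupp.single j 1 with hc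
  have hci : M.coroot i c = M.coroot i v := by
    rw [hc, map_add, map_smul, map_smul, coroot_single, coroot_single, bondCoeff_diag,
      smul_eq_mul, smul_eq_mul, ← hm, ← hp, hx, hy]
    field_simp
    ring
  have hcj : M.coroot j c = M.coroot j v := by
    rw [hc, map_add, map_smul, map_smul, coroot_single, coroot_single, bondCoeff_diag,
      M.symmetric j i, smul_eq_mul, smul_eq_mul, ← hm, ← hp, hx, hy]
    field_simp
    ring
  have hfix : (M.geomReflection i * M.geomReflection j) (v - c) = v - c := by
    rw [Module.End.mul_apply, geomReflection_apply M j, map_sub (M.coroot j), hcj, sub_self,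
      zero_smul, sub_zero, geomReflection_apply, map_sub (M.coroot i), hci, sub_self,
      zero_smul, sub_zero]
  have hfixn : ∀ n : ℕ, ((M.geomReflection i * M.geomReflection j) ^ n) (v - c) = v - c := by
    intro n
    induction n with
    | zero => simp
    | succ n ih => rw [pow_succ, Module.End.mul_apply, hfix, ih]
  have hplane : ((M.geomReflection i * M.geomReflection j) ^ m) c = c := by
    rw [hc, geomReflection_mul_pow_comb M hij, ← hm, dihedralCoeff_two_mul_self,
      dihedralCoeff_two_mul_self_add_one h1]
    simp
  calc ((M.geomReflection i * M.geomReflection j) ^ m) v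
      = ((M.geomReflection i * M.geomReflection j) ^ m) (v - c) +
          ((M.geomReflection i * M.geomReflection j) ^ m) c := by rw [← map_add, sub_add_cancel]
    _ = v := by rw [hfixn, hplane, sub_add_cancel]

end CoxeterMatrix

/-! ### Positivity of roots and right descents -/

namespace CoxeterMatrix

variable {B : Type*} (M : CoxeterMatrix B)

open CoxeterSystem in
/-- The image of a simple root under an alternating word, as a combination of simple roots. -/
lemma prod_map_alternatingWord_single {i j : B} (hij : i ≠ j) (n : ℕ) :
    ((alternatingWord i j n).map M.geomReflection).prod (Finsupp.single i 1) =
      if Even n then dihedralCoeff (M i j) (n + 1) • Finsupp.single i 1 +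
        dihedralCoeff (M i j) n • Finsupp.single j 1
      else dihedralCoeff (M i j) n • Finsupp.single i 1 +
        dihedralCoeff (M i j) (n + 1) • Finsupp.single j 1 := by
  induction n with
  | zero => simp [alternatingWord, dihedralCoeff_one (M.off_diagonal i j hij)]
  | succ n ih =>
    rw [alternatingWord_succ', List.map_cons, List.prod_cons, Module.End.mul_apply, ih]
    by_cases hn : Even n
    · rw [if_pos hn, if_pos hn, if_neg (by simpa [Nat.even_add_one] using hn), add_comm,
        geomReflection_comb, M.symmetric j i, dihedralCoeff_add_two, add_comm]
    · rw [if_neg hn, if_neg hn, if_pos (by simpa [Nat.even_add_one] using hn),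
        geomReflection_comb, dihedralCoeff_add_two]

end CoxeterMatrix

namespace CoxeterSystem

open CoxeterMatrix

variable {B W : Type*} [Group W] {M : CoxeterMatrix B} (cs : CoxeterSystem M W)

/-- The geometric representation of a Coxeter group. -/
noncomputable def geomRep : W →* Module.End ℝ (B →₀ ℝ) :=
  cs.lift ⟨M.geomReflection, M.isLiftable_geomReflection⟩

lemma geomRep_simple (i : B) : cs.geomRep (cs.simple i) = M.geomReflection i :=
  cs.lift_apply_simple M.isLiftable_geomReflection i

lemma geomRep_wordProd (ω : List B) :
    cs.geomRep (cs.wordProd ω) = (ω.map M.geomReflection).prod := by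
  induction ω with
  | nil => simp
  | cons i ω ih => rw [wordProd_cons, map_mul, ih, geomRep_simple, List.map_cons, List.prod_cons]

lemma geomRep_apply_ne_zero (w : W) {v : B →₀ ℝ} (hv : v ≠ 0) : cs.geomRep w v ≠ 0 := by
  intro h
  apply hv
  have : cs.geomRep (w⁻¹ * w) v = 0 := by rw [map_mul, Module.End.mul_apply, h, map_zero]
  simpa using this

/-- Every element is a product `v * a` with lengths adding, where `a` is an alternating word in
`i` and `j`, and `v` has neither `i` nor `j` as a right descent. -/
lemma exists_eq_mul_alternatingWord (i j : B) (w : W) :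
    ∃ (v : W) (a b : B) (n : ℕ), (a = i ∧ b = j ∨ a = j ∧ b = i) ∧
      w = v * cs.wordProd (alternatingWord a b n) ∧ cs.length w = cs.length v + n ∧
      ¬ cs.IsRightDescent v i ∧ ¬ cs.IsRightDescent v j := by
  -- Remove a right descent in `{i, j}` for as long as there is one.
  have key : ∀ k : ℕ, ∀ w : W, cs.length w = k → ∀ i j : B,
      ∃ (v : W) (a b : B) (n : ℕ), (a = i ∧ b = j ∨ a = j ∧ b = i) ∧
      w = v * cs.wordProd (alternatingWord a b n) ∧ cs.length w = cs.length v + n ∧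
      ¬ cs.IsRightDescent v i ∧ ¬ cs.IsRightDescent v j := by
    intro k
    induction k using Nat.strong_induction_on with
    | _ k ih =>
    intro w hk
    have step : ∀ i j : B, cs.IsRightDescent w j →
        ∃ (v : W) (a b : B) (n : ℕ), (a = i ∧ b = j ∨ a = j ∧ b = i) ∧
        w = v * cs.wordProd (alternatingWord a b n) ∧ cs.length w = cs.length v + n ∧
        ¬ cs.IsRightDescent v i ∧ ¬ cs.IsRightDescent v j := by
      intro i j hj
      have hlen := cs.isRightDescent_iff.mp hj
      obtain ⟨v, a, b, n, hab, hw, hl, hvi, hvj⟩ := ih _ (by omega) (w * cs.simple j) rfl i j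
      have hw' : w = v * cs.wordProd (alternatingWord a b n) * cs.simple j := by
        rw [← hw, simple_mul_simple_cancel_right]
      rcases Nat.eq_zero_or_pos n with rfl | hn
      · refine ⟨v, i, j, 1, Or.inl ⟨rfl, rfl⟩, ?_, by omega, hvi, hvj⟩
        simpa [alternatingWord] using hw'
      obtain ⟨n, rfl⟩ := Nat.exists_eq_add_of_le' hn
      rcases hab with ⟨rfl, rfl⟩ | ⟨rfl, rfl⟩
      · exfalso
        rw [alternatingWord_succ, wordProd_concat, ← mul_assoc,
          simple_mul_simple_cancel_right] at hw'
        have h1 := cs.length_mul_le v (cs.wordProd (alternatingWord b a n))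
        have h2 := cs.length_wordProd_le (alternatingWord b a n)
        rw [← hw'] at h1
        rw [length_alternatingWord] at h2
        omega
      · refine ⟨v, b, a, n + 1 + 1, Or.inl ⟨rfl, rfl⟩, ?_, by omega, hvi, hvj⟩
        rw [alternatingWord_succ, wordProd_concat, ← mul_assoc]
        exact hw'
    intro i j
    by_cases hj : cs.IsRightDescent w j
    · exact step i j hj
    by_cases hi : cs.IsRightDescent w i
    · obtain ⟨v, a, b, n, hab, h1, h2, h3, h4⟩ := step j i hi
      exact ⟨v, a, b, n, hab.symm, h1, h2, h4, h3⟩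
    · exact ⟨w, i, j, 0, Or.inl ⟨rfl, rfl⟩, by simp [alternatingWord], by simp, hi, hj⟩
  exact key _ w rfl i j

lemma le_of_length_mul_alternatingWord {v : W} {a b : B} {n : ℕ} (h0 : M a b ≠ 0)
    (hl : cs.length (v * cs.wordProd (alternatingWord a b n)) = cs.length v + n) : n ≤ M a b := by
  by_contra hlt
  apply cs.not_isReduced_alternatingWord a b h0 (not_le.mp hlt)
  have h1 := cs.length_mul_le v (cs.wordProd (alternatingWord a b n))
  have h2 := cs.length_wordProd_le (alternatingWord a b n)
  unfold IsReduced
  rw [length_alternatingWord] at *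
  omega

lemma isRightDescent_of_length_mul_alternatingWord {v : W} {a b : B} {n : ℕ}
    (hl : cs.length (v * cs.wordProd (alternatingWord a b (n + 1))) = cs.length v + (n + 1)) :
    cs.IsRightDescent (v * cs.wordProd (alternatingWord a b (n + 1))) b := by
  have h1 := cs.length_mul_le v (cs.wordProd (alternatingWord b a n))
  have h2 := cs.length_wordProd_le (alternatingWord b a n)
  rw [length_alternatingWord] at h2
  unfold IsRightDescent
  rw [hl, alternatingWord_succ, wordProd_concat, ← mul_assoc, simple_mul_simple_cancel_right]
  omega

/-- The combination of simple roots reached by a short alternating word is nonnegative. -/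
lemma geomRep_alternatingWord_nonneg {v : W} {a b : B} (hab : a ≠ b) {n : ℕ}
    (hn : M a b ≠ 0 → n + 1 ≤ M a b)
    (ha : 0 ≤ cs.geomRep v (Finsupp.single a 1)) (hb : 0 ≤ cs.geomRep v (Finsupp.single b 1)) :
    0 ≤ cs.geomRep (v * cs.wordProd (alternatingWord a b n)) (Finsupp.single a 1) := by
  have h1 := M.off_diagonal a b hab
  have hc1 : 0 ≤ dihedralCoeff (M a b) (n + 1) := dihedralCoeff_nonneg h1 hn
  have hc0 : 0 ≤ dihedralCoeff (M a b) n :=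
    dihedralCoeff_nonneg h1 fun h => (Nat.le_succ n).trans (hn h)
  rw [map_mul, Module.End.mul_apply, geomRep_wordProd, prod_map_alternatingWord_single M hab]
  split_ifs
  all_goals
    rw [map_add, map_smul, map_smul]
    exact add_nonneg (smul_nonneg (by assumption) ha) (smul_nonneg (by assumption) hb)

/-- The fundamental positivity theorem: `w` maps the simple root `α i` to a nonnegative combination
of simple roots unless `i` is a right descent of `w`. -/
theorem geomRep_nonneg_of_not_isRightDescent {w : W} {i : B} (hi : ¬ cs.IsRightDescent w i) :
    0 ≤ cs.geomRep w (Finsupp.single i 1) := by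
  induction hk : cs.length w using Nat.strong_induction_on generalizing w i with
  | _ k ih =>
  by_cases hw1 : w = 1
  · subst hw1
    simp
  obtain ⟨j, hj⟩ := cs.exists_rightDescent_of_ne_one hw1
  have hij : i ≠ j := by rintro rfl; exact hi hj
  obtain ⟨v, a, b, n, hab, hw, hl, hvi, hvj⟩ := cs.exists_eq_mul_alternatingWord i j w
  rcases n with _ | n
  · exfalso
    have hwv : w = v := by simpa [alternatingWord] using hw
    exact hvj (hwv ▸ hj)
  have hvi' := ih _ (by omega) hvi rfl
  have hvj' := ih _ (by omega) hvj rfl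
  have hl' := hl
  rw [hw] at hl'
  rcases hab with ⟨rfl, rfl⟩ | ⟨rfl, rfl⟩
  · rw [hw]
    refine cs.geomRep_alternatingWord_nonneg hij (fun h0 => ?_) hvi' hvj'
    refine (cs.le_of_length_mul_alternatingWord h0 hl').lt_of_ne fun hne => hi ?_
    -- A word of full length could also be written so as to end with the other letter.
    rw [hw, hne, ← braidWord, wordProd_braidWord_eq, braidWord, M.symmetric b a, ← hne]
    rw [hne, ← braidWord, wordProd_braidWord_eq, braidWord, M.symmetric b a, ← hne] at hl'
    exact cs.isRightDescent_of_length_mul_alternatingWord hl'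
  · exfalso
    apply hi
    rw [hw]
    exact cs.isRightDescent_of_length_mul_alternatingWord hl'

lemma not_geomRep_nonneg_of_isRightDescent {w : W} {i : B} (hi : cs.IsRightDescent w i) :
    ¬ 0 ≤ cs.geomRep w (Finsupp.single i 1) := by
  intro h
  have h' := cs.geomRep_nonneg_of_not_isRightDescent
    (cs.isRightDescent_iff_not_isRightDescent_mul.mp hi)
  rw [map_mul, Module.End.mul_apply, geomRep_simple, geomReflection_single_self, map_neg,
    Left.nonneg_neg_iff] at h'
  exact cs.geomRep_apply_ne_zero w (by simp) (le_antisymm h' h)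

/-- If `w` has two right descents `i ≠ j`, then `m = M i j` is finite and some reduced expression of
`w` ends with the alternating word of length `m`. -/
theorem exists_eq_mul_alternatingWord_of_isRightDescent {w : W} {i j : B} (hij : i ≠ j)
    (hi : cs.IsRightDescent w i) (hj : cs.IsRightDescent w j) :
    M i j ≠ 0 ∧ ∃ v : W, w = v * cs.wordProd (alternatingWord i j (M i j)) ∧
      cs.length w = cs.length v + M i j := by
  obtain ⟨v, a, b, n, hab, hw, hl, hvi, hvj⟩ := cs.exists_eq_mul_alternatingWord i j w
  have hl' := hl
  rw [hw] at hl'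
  have hvi' := cs.geomRep_nonneg_of_not_isRightDescent hvi
  have hvj' := cs.geomRep_nonneg_of_not_isRightDescent hvj
  rcases hab with ⟨rfl, rfl⟩ | ⟨rfl, rfl⟩
  · have hlong : ¬ (M a b ≠ 0 → n + 1 ≤ M a b) := fun hn =>
      cs.not_geomRep_nonneg_of_isRightDescent hi
        (hw ▸ cs.geomRep_alternatingWord_nonneg hij hn hvi' hvj')
    push Not at hlong
    obtain ⟨h0, hn⟩ := hlong
    have hn' : n = M a b := by
      have := cs.le_of_length_mul_alternatingWord h0 hl'
      omega
    exact ⟨h0, v, by rw [← hn']; exact hw, by rw [← hn']; exact hl⟩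
  · have hlong : ¬ (M a b ≠ 0 → n + 1 ≤ M a b) := fun hn =>
      cs.not_geomRep_nonneg_of_isRightDescent hj
        (hw ▸ cs.geomRep_alternatingWord_nonneg hij.symm hn hvj' hvi')
    push Not at hlong
    obtain ⟨h0, hn⟩ := hlong
    have hn' : n = M a b := by
      have := cs.le_of_length_mul_alternatingWord h0 hl'
      omega
    refine ⟨M.symmetric a b ▸ h0, v, ?_, by rw [M.symmetric b a, ← hn']; exact hl⟩
    rw [← braidWord, wordProd_braidWord_eq, braidWord, ← hn']
    exact hw

end CoxeterSystem

/-! ### Braid free words -/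

/-- The word of length `n` that starts with `i` and alternates between `i` and `j`. -/
def CoxeterMatrix.altWord {B : Type*} (i j : B) : ℕ → List B
  | 0 => []
  | n + 1 => i :: altWord j i n

namespace CoxeterMatrix

variable {B : Type*}

lemma alternatingWord_eq_altWord (i j : B) (n : ℕ) :
    CoxeterSystem.alternatingWord i j n = if Even n then altWord i j n else altWord j i n := by
  induction n with
  | zero => simp [CoxeterSystem.alternatingWord, altWord]
  | succ n ih =>
    rw [CoxeterSystem.alternatingWord_succ', ih]
    by_cases hn : Even n
    · rw [if_pos hn, if_pos hn, if_neg (by simpa [Nat.even_add_one] using hn)]; rfl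
    · rw [if_neg hn, if_neg hn, if_pos (by simpa [Nat.even_add_one] using hn)]; rfl

@[simp] lemma length_altWord (i j : B) (n : ℕ) : (altWord i j n).length = n := by
  induction n generalizing i j with
  | zero => rfl
  | succ n ih => simp [altWord, ih]

lemma altWord_prefix_of_le (i j : B) {m n : ℕ} (h : m ≤ n) : altWord i j m <+: altWord i j n := by
  induction m generalizing i j n with
  | zero => exact List.nil_prefix
  | succ m ih =>
    obtain ⟨n, rfl⟩ := Nat.exists_eq_add_of_le' (Nat.one_le_of_lt h)
    exact (List.prefix_cons_inj i).mpr (ih j i (by omega))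

variable (M : CoxeterMatrix B)

/-- A word is braid free if it has no two equal consecutive letters and no factor that alternates
between distinct `i` and `j` and has length `M i j`, so that neither a cancellation nor a braid
move can be applied to it. There is no braid move when `M i j = 0`, which encodes the label `∞`. -/
def IsBraidFree (ω : List B) : Prop :=
  ω.IsChain (· ≠ ·) ∧ ∀ i j, i ≠ j → M i j ≠ 0 → ¬ altWord i j (M i j) <:+: ω

variable {M}

lemma IsBraidFree.of_infix {ω η : List B} (h : M.IsBraidFree ω) (hη : η <:+: ω) :
    M.IsBraidFree η :=
  ⟨h.1.infix hη, fun i j hij h0 hi => h.2 i j hij h0 (hi.trans hη)⟩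

lemma IsBraidFree.not_alternatingWord_infix {ω : List B} (h : M.IsBraidFree ω) {i j : B}
    (hij : i ≠ j) (h0 : M i j ≠ 0) : ¬ CoxeterSystem.alternatingWord i j (M i j) <:+: ω := by
  rw [alternatingWord_eq_altWord]
  split_ifs
  · exact h.2 i j hij h0
  · rw [M.symmetric i j] at h0 ⊢
    exact h.2 j i hij.symm h0

end CoxeterMatrix

namespace CoxeterSystem

open CoxeterMatrix

variable {B W : Type*} [Group W] {M : CoxeterMatrix B} (cs : CoxeterSystem M W)

lemma wordProd_altWord_eq (i j : B) :
    cs.wordProd (altWord i j (M i j)) = cs.wordProd (altWord j i (M i j)) := by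
  have h := cs.wordProd_braidWord_eq i j
  rw [braidWord, braidWord, alternatingWord_eq_altWord, alternatingWord_eq_altWord,
    M.symmetric j i] at h
  split_ifs at h
  · exact h
  · exact h.symm

/-- A word to which neither a cancellation nor a braid move applies is reduced, and it is the only
reduced word for its product. -/
theorem isReduced_and_unique_of_isBraidFree {ω : List B} (h : M.IsBraidFree ω) :
    cs.IsReduced ω ∧ ∀ η, cs.IsReduced η → cs.wordProd η = cs.wordProd ω → η = ω := by
  induction ω using List.reverseRecOn with
  | nil =>
    refine ⟨by simp [IsReduced], fun η hη hp => ?_⟩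
    have := hη.eq
    rw [hp, wordProd_nil, length_one] at this
    exact List.length_eq_zero_iff.mp this.symm
  | append_singleton ω r ih =>
    obtain ⟨hred, huniq⟩ := ih (h.of_infix ⟨[], [r], by simp⟩)
    have hprod : cs.wordProd (ω ++ [r]) = cs.wordProd ω * cs.simple r := by
      rw [← List.concat_eq_append, wordProd_concat]
    have hred' : cs.IsReduced (ω ++ [r]) := by
      unfold IsReduced
      rw [hprod, List.length_append, List.length_singleton]
      rcases cs.length_mul_simple (cs.wordProd ω) r with h1 | h1
      · rw [h1, hred.eq]
      · -- Otherwise the reduced word `ω` ends with `r`, and `r` is repeated.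
        exfalso
        obtain ⟨η, hη, hηp⟩ := cs.exists_isReduced (cs.wordProd ω * cs.simple r)
        have hp : cs.wordProd (η ++ [r]) = cs.wordProd ω := by
          rw [← List.concat_eq_append, wordProd_concat, ← hηp, simple_mul_simple_cancel_right]
        have hω : η ++ [r] = ω := by
          refine huniq _ ?_ hp
          unfold IsReduced
          rw [hp, ← h1, hηp, hη.eq]
          simp
        have h2 := h.1
        rw [← hω, List.append_assoc, List.isChain_append] at h2
        simp at h2
    refine ⟨hred', fun η hη hp => ?_⟩
    rcases List.eq_nil_or_concat' η with rfl | ⟨η, t, rfl⟩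
    · have := hred'.eq
      rw [← hp] at this
      simp at this
    have hηprod : cs.wordProd (η ++ [t]) = cs.wordProd η * cs.simple t := by
      rw [← List.concat_eq_append, wordProd_concat]
    have hη' : cs.IsReduced η := by simpa using hη.take η.length
    by_cases htr : t = r
    · subst htr
      rw [hprod, hηprod, mul_left_inj] at hp
      rw [huniq η hη' hp]
    -- Two different last letters force a braid move at the end of the word.
    exfalso
    have hr : cs.IsRightDescent (cs.wordProd (ω ++ [r])) r := by
      rw [IsRightDescent, hred'.eq, hprod, simple_mul_simple_cancel_right, hred.eq]
      simp
    have ht : cs.IsRightDescent (cs.wordProd (ω ++ [r])) t := by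
      rw [← hp, IsRightDescent, hη.eq, hηprod, simple_mul_simple_cancel_right, hη'.eq]
      simp
    obtain ⟨h0, v, hv, hl⟩ := cs.exists_eq_mul_alternatingWord_of_isRightDescent htr ht hr
    obtain ⟨ν, hν, rfl⟩ := cs.exists_isReduced v
    obtain ⟨m, hm⟩ := Nat.exists_eq_succ_of_ne_zero h0
    rw [hm] at hl
    rw [hm, alternatingWord_succ, wordProd_concat, ← mul_assoc, ← wordProd_append, hprod,
      mul_left_inj] at hv
    have hω : ν ++ alternatingWord r t m = ω := by
      refine huniq _ ?_ hv.symm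
      unfold IsReduced
      rw [← hv, hred.eq, List.length_append, length_alternatingWord, ← hν.eq]
      rw [hred'.eq, List.length_append, List.length_singleton] at hl
      omega
    apply h.not_alternatingWord_infix htr h0
    refine ⟨ν, [], ?_⟩
    rw [hm, alternatingWord_succ, List.append_nil, List.concat_eq_append,
      ← List.append_assoc, hω]

lemma isBraidFree_of_unique {ω : List B} (hred : cs.IsReduced ω)
    (huniq : ∀ η, cs.IsReduced η → cs.wordProd η = cs.wordProd ω → η = ω) : M.IsBraidFree ω := by
  constructor
  · rw [List.isChain_iff_forall_rel_of_append_cons_cons]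
    rintro a b l₁ l₂ rfl rfl
    have hp : cs.wordProd (l₁ ++ a :: a :: l₂) = cs.wordProd (l₁ ++ l₂) := by
      simp [wordProd_append, wordProd_cons]
    have h1 := cs.length_wordProd_le (l₁ ++ l₂)
    rw [← hp, hred.eq] at h1
    simp at h1
  · rintro i j hij h0 ⟨l₁, l₂, rfl⟩
    have hp : cs.wordProd (l₁ ++ altWord j i (M i j) ++ l₂) =
        cs.wordProd (l₁ ++ altWord i j (M i j) ++ l₂) := by
      simp only [wordProd_append]
      rw [cs.wordProd_altWord_eq i j]
    have hη := huniq _ (by rw [IsReduced, hp, hred.eq]; simp) hp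
    rw [List.append_cancel_right_eq, List.append_cancel_left_eq] at hη
    obtain ⟨m, hm⟩ := Nat.exists_eq_succ_of_ne_zero h0
    rw [hm, altWord, altWord] at hη
    exact hij (List.cons.inj hη).1.symm

/-- The elements with a unique reduced expression correspond to the braid free words. -/
theorem numUniqueReduced_eq_encard_isBraidFree :
    cs.numUniqueReduced = {ω : List B | M.IsBraidFree ω}.encard := by
  have hinj : Set.InjOn cs.wordProd {ω : List B | M.IsBraidFree ω} := fun ω hω η hη h =>
    (cs.isReduced_and_unique_of_isBraidFree hη).2 ω
      (cs.isReduced_and_unique_of_isBraidFree hω).1 h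
  rw [numUniqueReduced, ← hinj.encard_image]
  congr 1
  ext w
  constructor
  · rintro ⟨ω, ⟨hω, rfl⟩, huniq⟩
    exact ⟨ω, cs.isBraidFree_of_unique hω fun η h1 h2 => huniq η ⟨h1, h2⟩, rfl⟩
  · rintro ⟨ω, hω, rfl⟩
    obtain ⟨h1, h2⟩ := cs.isReduced_and_unique_of_isBraidFree hω
    exact ⟨ω, ⟨h1, rfl⟩, fun η hη => h2 η hη.1 hη.2⟩

end CoxeterSystem

/-! ### Paths in trees and the two sides of an edge -/

namespace SimpleGraph.IsTree

variable {V : Type*} {G : SimpleGraph V}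

/-- The list of vertices of the unique path from `u` to `v` in a tree. -/
noncomputable def pathList (hG : G.IsTree) (u v : V) : List V :=
  (hG.existsUnique_path u v).choose.support

lemma pathList_eq (hG : G.IsTree) {u v : V} {p : G.Walk u v} (hp : p.IsPath) :
    hG.pathList u v = p.support := by
  rw [pathList, (hG.existsUnique_path u v).unique (hG.existsUnique_path u v).choose_spec.1 hp]

lemma exists_pathList_eq (hG : G.IsTree) (u v : V) :
    ∃ p : G.Walk u v, p.IsPath ∧ hG.pathList u v = p.support :=
  ⟨_, (hG.existsUnique_path u v).choose_spec.1, rfl⟩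

@[simp] lemma pathList_self (hG : G.IsTree) (u : V) : hG.pathList u u = [u] :=
  hG.pathList_eq (p := Walk.nil) Walk.IsPath.nil

lemma pathList_cons (hG : G.IsTree) {u x v : V} (h : G.Adj u x) (hu : u ∉ hG.pathList x v) :
    hG.pathList u v = u :: hG.pathList x v := by
  obtain ⟨p, hp, he⟩ := hG.exists_pathList_eq x v
  rw [he] at hu ⊢
  exact hG.pathList_eq (p := Walk.cons h p) (hp.cons hu)

lemma exists_pathList_eq_cons (hG : G.IsTree) {u v : V} (h : u ≠ v) :
    ∃ x, G.Adj u x ∧ u ∉ hG.pathList x v ∧ hG.pathList u v = u :: hG.pathList x v := by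
  obtain ⟨p, hp, he⟩ := hG.exists_pathList_eq u v
  cases p with
  | nil => exact absurd rfl h
  | @cons _ x _ hux p =>
    rw [Walk.cons_isPath_iff] at hp
    have hx : hG.pathList x v = p.support := hG.pathList_eq hp.1
    exact ⟨x, hux, hx ▸ hp.2, by rw [he, hx, Walk.support_cons]⟩

/-- Induction on the length of the path from `u` to a fixed vertex `v` of a tree. -/
lemma path_induction (hG : G.IsTree) {v : V} {P : V → Prop} (self : P v)
    (cons : ∀ u x, u ≠ v → G.Adj u x → u ∉ hG.pathList x v →
      hG.pathList u v = u :: hG.pathList x v → P x → P u) (u : V) : P u := by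
  induction hn : (hG.pathList u v).length generalizing u with
  | zero =>
    obtain ⟨p, -, he⟩ := hG.exists_pathList_eq u v
    rw [he] at hn
    simp at hn
  | succ n ih =>
    by_cases h : u = v
    · exact h ▸ self
    · obtain ⟨x, h1, h2, h3⟩ := hG.exists_pathList_eq_cons h
      exact cons u x h h1 h2 h3 (ih x (by simpa [h3] using hn))

lemma exists_pathList_head (hG : G.IsTree) (u v : V) : ∃ l, hG.pathList u v = u :: l := by
  obtain ⟨p, -, he⟩ := hG.exists_pathList_eq u v
  exact ⟨p.support.tail, by rw [he, Walk.cons_tail_support]⟩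

lemma exists_pathList_last (hG : G.IsTree) (u v : V) : ∃ l, hG.pathList u v = l ++ [v] := by
  obtain ⟨p, -, he⟩ := hG.exists_pathList_eq u v
  refine ⟨p.support.dropLast, ?_⟩
  rw [he]
  have := List.dropLast_append_getLast p.support_ne_nil
  rw [Walk.getLast_support] at this
  exact this.symm

/-- A neighbour `u` of `x` either extends the path from `x` to `v`, or is its second vertex. -/
lemma pathList_cons_or (hG : G.IsTree) {u x : V} (v : V) (h : G.Adj u x) :
    hG.pathList u v = u :: hG.pathList x v ∨ hG.pathList x v = x :: hG.pathList u v := by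
  by_cases hu : u ∈ hG.pathList x v
  · right
    obtain ⟨p, hp, he⟩ := hG.exists_pathList_eq x v
    cases p with
    | nil =>
      rw [he, Walk.support_nil, List.mem_singleton] at hu
      exact absurd (hu ▸ h) (G.irrefl)
    | @cons _ y _ hxy p =>
      have hsnd := hG.isAcyclic.eq_snd_of_adj_start hp h.symm (he ▸ hu)
      rw [Walk.snd_cons] at hsnd
      subst hsnd
      rw [Walk.cons_isPath_iff] at hp
      rw [he, Walk.support_cons, hG.pathList_eq hp.1]
  · exact Or.inl (hG.pathList_cons h hu)

end SimpleGraph.IsTree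

namespace SimpleGraph

variable {V : Type*} (G : SimpleGraph V)

/-- The vertex `x` lies in the same component as `r` once the edge `r s` is removed. -/
def OnSide (r s x : V) : Prop := (G.deleteEdges {s(r, s)}).Reachable r x

variable {G} {r s : V}

lemma onSide_self : G.OnSide r s r := Reachable.refl r

lemma IsTree.not_onSide (hG : G.IsTree) (hrs : G.Adj r s) : ¬ G.OnSide r s s :=
  isAcyclic_iff_forall_adj_isBridge.mp hG.isAcyclic hrs

lemma onSide_iff_of_adj {x y : V} (h : G.Adj x y) (he : s(x, y) ≠ s(r, s)) :
    G.OnSide r s x ↔ G.OnSide r s y := by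
  have h' : (G.deleteEdges {s(r, s)}).Adj x y := by
    rw [deleteEdges_adj]
    exact ⟨h, by simpa using he⟩
  exact ⟨fun hx => hx.trans h'.reachable, fun hy => hy.trans h'.symm.reachable⟩

lemma IsTree.not_onSide_iff (hG : G.IsTree) (hrs : G.Adj r s) (x : V) :
    ¬ G.OnSide r s x ↔ (G.deleteEdges {s(r, s)}).Reachable s x := by
  constructor
  · intro hx
    refine hG.path_induction (v := s) (P := fun x => ¬ G.OnSide r s x →
      (G.deleteEdges {s(r, s)}).Reachable s x) (fun _ => Reachable.refl s) ?_ x hx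
    intro u y hus huy _ _ ih hu
    by_cases he : s(u, y) = s(r, s)
    · rcases Sym2.eq_iff.mp he with ⟨rfl, rfl⟩ | ⟨rfl, rfl⟩
      · exact absurd onSide_self hu
      · exact absurd rfl hus
    · have h' : (G.deleteEdges {s(r, s)}).Adj u y := by
        rw [deleteEdges_adj]
        exact ⟨huy, by simpa using he⟩
      exact (ih fun hy => hu ((onSide_iff_of_adj huy he).mpr hy)).trans h'.symm.reachable
  · intro hx hr
    exact hG.not_onSide hrs (hr.trans hx.symm)

/-- The path between two vertices on the same side stays there. -/
lemma IsTree.onSide_iff_of_mem_pathList (hG : G.IsTree) (hrs : G.Adj r s) {u v x : V}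
    (h : G.OnSide r s u ↔ G.OnSide r s v) (hx : x ∈ hG.pathList u v) :
    G.OnSide r s x ↔ G.OnSide r s v := by
  classical
  have hr : (G.deleteEdges {s(r, s)}).Reachable u v := by
    by_cases hu : G.OnSide r s u
    · exact Reachable.trans (Reachable.symm hu) (h.mp hu)
    · exact ((hG.not_onSide_iff hrs u).mp hu).symm.trans
        ((hG.not_onSide_iff hrs v).mp fun hv => hu (h.mpr hv))
  obtain ⟨p⟩ := hr
  have hp := p.toPath.2
  have hle : G.deleteEdges {s(r, s)} ≤ G := deleteEdges_le _
  rw [hG.pathList_eq (hp.mapLe hle), Walk.support_mapLe_eq_support] at hx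
  have hxv : (G.deleteEdges {s(r, s)}).Reachable x v := (p.toPath.1.dropUntil x hx).reachable
  exact ⟨fun h => h.trans hxv, fun h => h.trans hxv.symm⟩

end SimpleGraph

/-! ### Walks that turn back on a single edge of a tree -/

namespace SimpleGraph

variable {V : Type*} (G : SimpleGraph V)

open Classical in
/-- The end of the edge `r s` on the side of `x`. -/
noncomputable def nearEnd (r s x : V) : V := if G.OnSide r s x then r else s

open Classical in
/-- The end of the edge `r s` on the side away from `x`. -/
noncomputable def farEnd (r s x : V) : V := if G.OnSide r s x then s else r

variable {G} {r s : V}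

lemma nearEnd_farEnd_cases (r s x : V) :
    G.nearEnd r s x = r ∧ G.farEnd r s x = s ∨ G.nearEnd r s x = s ∧ G.farEnd r s x = r := by
  unfold nearEnd farEnd
  split_ifs <;> simp

lemma adj_nearEnd_farEnd (hrs : G.Adj r s) (x : V) :
    G.Adj (G.nearEnd r s x) (G.farEnd r s x) := by
  rcases nearEnd_farEnd_cases (G := G) r s x with ⟨h1, h2⟩ | ⟨h1, h2⟩
  · rwa [h1, h2]
  · rw [h1, h2]; exact hrs.symm

lemma nearEnd_congr {x y : V} (h : G.OnSide r s x ↔ G.OnSide r s y) :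
    G.nearEnd r s x = G.nearEnd r s y := by
  unfold nearEnd
  split_ifs <;> tauto

lemma farEnd_congr {x y : V} (h : G.OnSide r s x ↔ G.OnSide r s y) :
    G.farEnd r s x = G.farEnd r s y := by
  unfold farEnd
  split_ifs <;> tauto

namespace IsTree

variable (hG : G.IsTree) (hrs : G.Adj r s)
include hG hrs

lemma onSide_nearEnd (x : V) : G.OnSide r s (G.nearEnd r s x) ↔ G.OnSide r s x := by
  unfold nearEnd
  split_ifs with h
  · simp [h, onSide_self]
  · simp [h, hG.not_onSide hrs]

lemma onSide_farEnd (x : V) : G.OnSide r s (G.farEnd r s x) ↔ ¬ G.OnSide r s x := by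
  unfold farEnd
  split_ifs with h
  · simp [h, hG.not_onSide hrs]
  · simp [h, onSide_self]

lemma nearEnd_nearEnd (x : V) : G.nearEnd r s (G.nearEnd r s x) = G.nearEnd r s x :=
  nearEnd_congr (hG.onSide_nearEnd hrs x)

lemma farEnd_nearEnd (x : V) : G.farEnd r s (G.nearEnd r s x) = G.farEnd r s x :=
  farEnd_congr (hG.onSide_nearEnd hrs x)

lemma nearEnd_farEnd (x : V) : G.nearEnd r s (G.farEnd r s x) = G.farEnd r s x := by
  have h := hG.onSide_farEnd hrs x
  unfold nearEnd
  by_cases hx : G.OnSide r s x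
  · rw [if_neg (by simpa [hx] using h)]; simp [farEnd, hx]
  · rw [if_pos (by simpa [hx] using h)]; simp [farEnd, hx]

lemma farEnd_farEnd (x : V) : G.farEnd r s (G.farEnd r s x) = G.nearEnd r s x := by
  have h := hG.onSide_farEnd hrs x
  rw [farEnd]
  by_cases hx : G.OnSide r s x
  · rw [if_neg (by simpa [hx] using h)]; simp [nearEnd, hx]
  · rw [if_pos (by simpa [hx] using h)]; simp [nearEnd, hx]

lemma eq_nearEnd_farEnd_of_mk_eq {u x : V} (h : s(u, x) = s(r, s)) :
    G.nearEnd r s u = u ∧ G.farEnd r s u = x := by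
  unfold nearEnd farEnd
  rcases Sym2.eq_iff.mp h with ⟨rfl, rfl⟩ | ⟨rfl, rfl⟩
  · simp [onSide_self]
  · simp [hG.not_onSide hrs]

omit hrs in
variable (r s) in
/-- The walk from `u` to `v` in a tree that crosses the edge `r s` exactly `j` times and turns back
only on that edge, provided that `j` has the parity imposed by the sides of `u` and `v`; for the
other parity the final path crosses the edge once more. -/
noncomputable def crossWord : ℕ → V → V → List V
  | 0, u, v => hG.pathList u v
  | j + 1, u, v => hG.pathList u (G.nearEnd r s u) ++ crossWord j (G.farEnd r s u) v

omit hrs in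
variable (r s) in
lemma exists_crossWord_head (j : ℕ) (u v : V) : ∃ l, hG.crossWord r s j u v = u :: l := by
  cases j with
  | zero => exact hG.exists_pathList_head u v
  | succ j =>
    obtain ⟨l, hl⟩ := hG.exists_pathList_head u (G.nearEnd r s u)
    exact ⟨_, by rw [crossWord, hl, List.cons_append]⟩

omit hrs in
variable (r s) in
lemma exists_crossWord_last (j : ℕ) (u v : V) : ∃ l, hG.crossWord r s j u v = l ++ [v] := by
  induction j generalizing u with
  | zero => exact hG.exists_pathList_last u v
  | succ j ih =>
    obtain ⟨l, hl⟩ := ih (G.farEnd r s u)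
    exact ⟨_, by rw [crossWord, hl, ← List.append_assoc]⟩

lemma crossWord_succ_nearEnd (j : ℕ) (u v : V) :
    hG.crossWord r s (j + 1) (G.nearEnd r s u) v =
      G.nearEnd r s u :: hG.crossWord r s j (G.farEnd r s u) v := by
  rw [crossWord, hG.nearEnd_nearEnd hrs, hG.farEnd_nearEnd hrs, pathList_self]
  rfl

omit hrs in
/-- Moving the start of a crossing walk along an edge other than `r s` prolongs or shortens it. -/
lemma crossWord_cons_or {u x : V} (j : ℕ) (v : V) (h : G.Adj u x) (he : s(u, x) ≠ s(r, s)) :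
    hG.crossWord r s j u v = u :: hG.crossWord r s j x v ∨
      hG.crossWord r s j x v = x :: hG.crossWord r s j u v := by
  have hs := onSide_iff_of_adj h he
  cases j with
  | zero => exact hG.pathList_cons_or v h
  | succ j =>
    rw [crossWord, crossWord, nearEnd_congr hs, farEnd_congr hs]
    rcases hG.pathList_cons_or (G.nearEnd r s x) h with h1 | h1
    · exact Or.inl (by rw [h1]; rfl)
    · exact Or.inr (by rw [h1]; rfl)

lemma crossWord_cons_of_mk_eq {u x : V} (j : ℕ) (v : V) (he : s(u, x) = s(r, s)) :
    hG.crossWord r s (j + 1) u v = u :: hG.crossWord r s j x v := by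
  obtain ⟨h1, h2⟩ := hG.eq_nearEnd_farEnd_of_mk_eq hrs he
  have := hG.crossWord_succ_nearEnd hrs j u v
  rwa [h1, h2] at this

lemma farEnd_notMem_pathList_nearEnd {u x : V} (h : G.OnSide r s x ↔ G.OnSide r s u) :
    G.farEnd r s u ∉ hG.pathList x (G.nearEnd r s u) := by
  intro hmem
  have := hG.onSide_iff_of_mem_pathList hrs (h.trans (hG.onSide_nearEnd hrs u).symm) hmem
  rw [hG.onSide_farEnd hrs, hG.onSide_nearEnd hrs] at this
  exact not_iff_self this

/-- The number of crossings is determined by the walk. -/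
lemma crossWord_inj {j k : ℕ} {u v : V}
    (hj : (G.OnSide r s u ↔ G.OnSide r s v) ↔ Even j)
    (hk : (G.OnSide r s u ↔ G.OnSide r s v) ↔ Even k)
    (h : hG.crossWord r s j u v = hG.crossWord r s k u v) : j = k := by
  -- A walk that crosses the edge meets both sides, and a walk without crossings does not.
  have key : ∀ k u, ((G.OnSide r s u ↔ G.OnSide r s v) ↔ Even 0) →
      hG.crossWord r s 0 u v ≠ hG.crossWord r s (k + 1) u v := by
    intro k u h0 he
    have hs : G.OnSide r s u ↔ G.OnSide r s v := h0.mpr (by simp)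
    have h1 : G.farEnd r s u ∈ hG.pathList u v := by
      obtain ⟨l, hl⟩ := hG.exists_crossWord_head r s k (G.farEnd r s u) v
      rw [crossWord, crossWord, hl] at he
      simp [he]
    have h2 := hG.onSide_iff_of_mem_pathList hrs hs h1
    rw [hG.onSide_farEnd hrs, ← hs] at h2
    exact not_iff_self h2
  induction j generalizing u k with
  | zero =>
    cases k with
    | zero => rfl
    | succ k => exact absurd h (key k u hj)
  | succ j ih =>
    cases k with
    | zero => exact absurd h.symm (key j u hk)
    | succ k =>
      rw [crossWord, crossWord, List.append_cancel_left_eq] at h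
      have hf := hG.onSide_farEnd hrs u
      rw [Nat.even_add_one] at hj hk
      rw [ih (by rw [hf]; tauto) (by rw [hf]; tauto) h]

end IsTree

end SimpleGraph

namespace CoxeterMatrix

variable {B : Type*} {M : CoxeterMatrix B}

lemma coxeterGraph_adj_iff {i j : B} : M.coxeterGraph.Adj i j ↔ i ≠ j ∧ M i j ≠ 2 := by
  refine and_congr_right fun hij => ?_
  have h1 := M.off_diagonal i j hij
  unfold edgeLabel
  split_ifs with h0
  · simp [h0]
  · rw [show (3 : ℕ∞) = ((3 : ℕ) : ℕ∞) from rfl, Nat.cast_le]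
    omega

lemma three_le_of_adj {i j : B} (h : M.coxeterGraph.Adj i j) (h0 : M i j ≠ 0) : 3 ≤ M i j := by
  have h1 := M.off_diagonal i j h.ne
  have h2 := (coxeterGraph_adj_iff.mp h).2
  omega

lemma altWord_prefix_iff {i j : B} {n : ℕ} {ω : List B} :
    altWord i j (n + 1) <+: i :: ω ↔ altWord j i n <+: ω :=
  List.prefix_cons_inj i

lemma isBraidFree_nil : M.IsBraidFree [] := by
  refine ⟨List.isChain_nil, fun i j _ h0 h => h0 ?_⟩
  have := h.length_le
  simpa using this

lemma isBraidFree_singleton (i : B) : M.IsBraidFree [i] := by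
  refine ⟨List.isChain_singleton i, fun j k hjk h0 h => ?_⟩
  have := h.length_le
  have := M.off_diagonal j k hjk
  simp at *
  omega

/-- Only a prefix of the word can spoil braid freeness when a letter is added in front. -/
lemma IsBraidFree.cons {i j : B} {ω : List B} (h : M.IsBraidFree (j :: ω))
    (hij : M.coxeterGraph.Adj i j) (hp : M i j ≠ 0 → ¬ altWord i j (M i j) <+: i :: j :: ω) :
    M.IsBraidFree (i :: j :: ω) := by
  refine ⟨List.isChain_cons_cons.mpr ⟨hij.ne, h.1⟩, fun a b hab h0 hinf => ?_⟩
  rcases List.infix_cons_iff.mp hinf with hpre | hinf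
  · have h1 := M.off_diagonal a b hab
    obtain ⟨n, hn⟩ : ∃ n, M a b = n + 1 + 1 := ⟨M a b - 2, by omega⟩
    have hpre' := hpre
    rw [hn, altWord, altWord, List.cons_prefix_cons, List.cons_prefix_cons] at hpre'
    obtain ⟨rfl, rfl, -⟩ := hpre'
    exact hp h0 hpre
  · exact h.2 a b hab h0 hinf

lemma IsBraidFree.adj {i j : B} {ω : List B} (h : M.IsBraidFree (i :: j :: ω)) :
    M.coxeterGraph.Adj i j := by
  have hij : i ≠ j := (List.isChain_cons_cons.mp h.1).1
  refine coxeterGraph_adj_iff.mpr ⟨hij, fun h2 => h.2 i j hij (by omega) ?_⟩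
  rw [h2]
  exact ⟨[], ω, rfl⟩

lemma IsBraidFree.tail {i : B} {ω : List B} (h : M.IsBraidFree (i :: ω)) : M.IsBraidFree ω :=
  h.of_infix ⟨[i], [], by simp⟩

/-- A path leading to a braid free word `e :: ω` extends it to a braid free word if the first letter
of `ω` is not on the path. -/
lemma IsBraidFree.pathList_append (hT : M.coxeterGraph.IsTree) {e u : B} {ω : List B}
    (h : M.IsBraidFree (e :: ω)) (hω : ∀ y ∈ ω.head?, y ∉ hT.pathList u e) :
    M.IsBraidFree (hT.pathList u e ++ ω) := by
  revert hω
  refine hT.path_induction (v := e) (P := fun u => (∀ y ∈ ω.head?, y ∉ hT.pathList u e) →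
    M.IsBraidFree (hT.pathList u e ++ ω)) (fun _ => by simpa using h) ?_ u
  intro u x _ hux hu hux' ih hω
  have ih' := ih fun y hy hmem => hω y hy (by rw [hux']; exact List.mem_cons_of_mem u hmem)
  obtain ⟨l, hl⟩ := hT.exists_pathList_head x e
  rw [hux', List.cons_append]
  rw [hl, List.cons_append] at ih' ⊢
  refine ih'.cons hux fun h0 hpre => ?_
  have h3 := three_le_of_adj hux h0
  obtain ⟨n, hn⟩ : ∃ n, M u x = n + 1 + 1 + 1 := ⟨M u x - 3, by omega⟩
  rw [hn, altWord_prefix_iff, altWord_prefix_iff, altWord] at hpre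
  cases l with
  | nil =>
    obtain ⟨t, ht⟩ := hpre
    rw [List.nil_append] at ht
    refine hω u (by rw [← ht]; simp) ?_
    rw [hux']; exact List.mem_cons_self
  | cons y l =>
    rw [List.cons_append, List.cons_prefix_cons] at hpre
    apply hu
    rw [hl, hpre.1]
    simp

lemma apply_nearEnd_farEnd (r s u : B) :
    M (M.coxeterGraph.nearEnd r s u) (M.coxeterGraph.farEnd r s u) = M r s := by
  rcases SimpleGraph.nearEnd_farEnd_cases (G := M.coxeterGraph) r s u with ⟨h1, h2⟩ | ⟨h1, h2⟩
  · rw [h1, h2]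
  · rw [h1, h2, M.symmetric]

section Tree

variable (hT : M.coxeterGraph.IsTree) {r s : B} (hrs : M.coxeterGraph.Adj r s)
include hT hrs

/-- A walk that starts at an end of the edge `r s` and crosses it `j` times alternates between the
ends for at most `j + 1` letters at its start; `altWord_prefix_crossWord` shows that this is exact. -/
lemma le_of_altWord_prefix_crossWord {j n : ℕ} {u v : B}
    (hj : (M.coxeterGraph.OnSide r s u ↔ M.coxeterGraph.OnSide r s v) ↔ Even j)
    (h : altWord (M.coxeterGraph.nearEnd r s u) (M.coxeterGraph.farEnd r s u) n <+:
      hT.crossWord r s j (M.coxeterGraph.nearEnd r s u) v) : n ≤ j + 1 := by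
  induction j generalizing u n with
  | zero =>
    by_contra hn
    obtain ⟨k, rfl⟩ : ∃ k, n = k + 1 + 1 := ⟨n - 2, by omega⟩
    have hs : M.coxeterGraph.OnSide r s u ↔ M.coxeterGraph.OnSide r s v := hj.mpr (by simp)
    have hmem : M.coxeterGraph.farEnd r s u ∈
        hT.pathList (M.coxeterGraph.nearEnd r s u) v :=
      h.subset (by simp [altWord])
    have h2 := hT.onSide_iff_of_mem_pathList hrs ((hT.onSide_nearEnd hrs u).trans hs) hmem
    rw [hT.onSide_farEnd hrs, ← hs] at h2
    exact not_iff_self h2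
  | succ j ih =>
    cases n with
    | zero => omega
    | succ n =>
      rw [hT.crossWord_succ_nearEnd hrs, altWord_prefix_iff] at h
      have hf := hT.onSide_farEnd hrs u
      have := @ih n (M.coxeterGraph.farEnd r s u)
        (by rw [hf]; rw [Nat.even_add_one] at hj; tauto)
        (by rwa [hT.nearEnd_farEnd hrs, hT.farEnd_farEnd hrs])
      omega

lemma altWord_prefix_crossWord (j : ℕ) (u v : B) :
    altWord (M.coxeterGraph.nearEnd r s u) (M.coxeterGraph.farEnd r s u) (j + 1) <+:
      hT.crossWord r s j (M.coxeterGraph.nearEnd r s u) v := by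
  induction j generalizing u with
  | zero =>
    obtain ⟨l, hl⟩ := hT.exists_crossWord_head r s 0 (M.coxeterGraph.nearEnd r s u) v
    rw [hl, altWord_prefix_iff]
    exact List.nil_prefix
  | succ j ih =>
    have := ih (M.coxeterGraph.farEnd r s u)
    rw [hT.nearEnd_farEnd hrs, hT.farEnd_farEnd hrs] at this
    rwa [hT.crossWord_succ_nearEnd hrs, altWord_prefix_iff]

lemma isBraidFree_crossWord {j : ℕ} {u v : B} (hm : j + 2 ≤ M r s)
    (hj : (M.coxeterGraph.OnSide r s u ↔ M.coxeterGraph.OnSide r s v) ↔ Even j) :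
    M.IsBraidFree (hT.crossWord r s j u v) := by
  induction j generalizing u with
  | zero =>
    have := (isBraidFree_singleton (M := M) v).pathList_append hT (u := u) (ω := []) (by simp)
    rwa [List.append_nil] at this
  | succ j ih =>
    have hf := hT.onSide_farEnd hrs u
    have ih' := @ih (M.coxeterGraph.farEnd r s u) (by omega)
      (by rw [hf]; rw [Nat.even_add_one] at hj; tauto)
    have hadj := SimpleGraph.adj_nearEnd_farEnd (G := M.coxeterGraph) hrs u
    have hnext : M.IsBraidFree
        (M.coxeterGraph.nearEnd r s u ::
          hT.crossWord r s j (M.coxeterGraph.farEnd r s u) v) := by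
      have hpre := @le_of_altWord_prefix_crossWord _ _ hT r s hrs (j + 1) (M r s) u v hj
      rw [hT.crossWord_succ_nearEnd hrs] at hpre
      obtain ⟨l, hl⟩ := hT.exists_crossWord_head r s j (M.coxeterGraph.farEnd r s u) v
      rw [hl] at ih' hpre ⊢
      refine ih'.cons hadj fun _ h => ?_
      rw [apply_nearEnd_farEnd] at h
      have := hpre h
      omega
    rw [SimpleGraph.IsTree.crossWord]
    refine hnext.pathList_append hT fun y hy => ?_
    obtain ⟨l, hl⟩ := hT.exists_crossWord_head r s j (M.coxeterGraph.farEnd r s u) v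
    rw [hl, List.head?_cons, Option.mem_some] at hy
    subst hy
    exact hT.farEnd_notMem_pathList_nearEnd hrs Iff.rfl

/-- If all edges other than `r s` have label `3`, then every nonempty braid free word is a walk that
turns back only on `r s`. -/
lemma IsBraidFree.exists_eq_crossWord (h0 : M r s ≠ 0)
    (h3 : ∀ i j, M.coxeterGraph.Adj i j → s(i, j) ≠ s(r, s) → M i j = 3)
    {u : B} {ω : List B} (h : M.IsBraidFree (u :: ω)) :
    ∃ (j : ℕ) (v : B), j + 2 ≤ M r s ∧
      ((M.coxeterGraph.OnSide r s u ↔ M.coxeterGraph.OnSide r s v) ↔ Even j) ∧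
      u :: ω = hT.crossWord r s j u v := by
  induction ω generalizing u with
  | nil =>
    have := three_le_of_adj hrs h0
    exact ⟨0, u, by omega, by simp, by rw [SimpleGraph.IsTree.crossWord, hT.pathList_self]⟩
  | cons x ω ih =>
    obtain ⟨j, v, hm, hj, he⟩ := ih h.tail
    have hux := h.adj
    by_cases hedge : s(u, x) = s(r, s)
    · obtain ⟨h1, h2⟩ := hT.eq_nearEnd_farEnd_of_mk_eq hrs hedge
      have heq : u :: x :: ω = hT.crossWord r s (j + 1) u v := by
        rw [hT.crossWord_cons_of_mk_eq hrs j v hedge, ← he]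
      have hMux : M u x = M r s := by rw [← apply_nearEnd_farEnd r s u, h1, h2]
      refine ⟨j + 1, v, ?_, ?_, heq⟩
      · by_contra hlt
        have hpre := altWord_prefix_crossWord hT hrs (j + 1) u v
        rw [h1, h2, ← heq] at hpre
        refine h.2 u x hux.ne (hMux ▸ h0) (List.IsPrefix.isInfix ?_)
        exact (altWord_prefix_of_le u x (by omega)).trans hpre
      · have hf := hT.onSide_farEnd hrs u
        rw [h2] at hf
        rw [Nat.even_add_one, ← hj, hf]
        tauto
    · have hs := SimpleGraph.onSide_iff_of_adj (G := M.coxeterGraph) hux hedge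
      refine ⟨j, v, hm, by rw [hs]; exact hj, ?_⟩
      rcases hT.crossWord_cons_or j v hux hedge with h1 | h1
      · rw [h1, he]
      · -- Otherwise the word would start with the forbidden factor `u x u`.
        exfalso
        have hM := h3 u x hux hedge
        refine h.2 u x hux.ne (by omega) (List.IsPrefix.isInfix ?_)
        obtain ⟨l, hl⟩ := hT.exists_crossWord_head r s j u v
        rw [hM, he, h1, hl]
        exact ⟨l, rfl⟩

end Tree

end CoxeterMatrix

/-! ### Counting braid free words -/

namespace CoxeterMatrix

variable {B : Type*} {M : CoxeterMatrix B}

open Finset in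
lemma sum_range_ite_even (k X Y : ℕ) :
    ∑ j ∈ range k, (if Even j then X else Y) = (k + 1) / 2 * X + k / 2 * Y := by
  induction k with
  | zero => simp
  | succ k ih =>
    rw [sum_range_succ, ih]
    rcases Nat.even_or_odd' k with ⟨t, rfl | rfl⟩
    · rw [if_pos (by simp), show (2 * t + 1 + 1) / 2 = t + 1 by omega,
        show (2 * t + 1) / 2 = t by omega, show 2 * t / 2 = t by omega]
      ring
    · rw [if_neg (by simp), show (2 * t + 1 + 1 + 1) / 2 = t + 1 by omega,
        show (2 * t + 1 + 1) / 2 = t + 1 by omega, show (2 * t + 1) / 2 = t by omega]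
      ring

lemma partSize_eq [Fintype B] {r s : B} [DecidablePred (M.coxeterGraph.OnSide r s)] :
    M.partSize r s = (Finset.univ.filter fun x => M.coxeterGraph.OnSide r s x).card := by
  rw [partSize, ← Set.ncard_coe_finset]
  congr 1
  ext x
  simp only [SimpleGraph.ConnectedComponent.mem_supp_iff, SimpleGraph.ConnectedComponent.eq,
    Finset.coe_filter, Finset.mem_univ, true_and, Set.mem_ofPred_eq]
  exact SimpleGraph.reachable_comm

lemma partSize_swap_eq [Fintype B] {r s : B} [DecidablePred (M.coxeterGraph.OnSide r s)]
    (hT : M.coxeterGraph.IsTree) (hrs : M.coxeterGraph.Adj r s) :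
    M.partSize s r = (Finset.univ.filter fun x => ¬ M.coxeterGraph.OnSide r s x).card := by
  rw [partSize, ← Set.ncard_coe_finset]
  congr 1
  ext x
  simp [hT.not_onSide_iff hrs, SimpleGraph.ConnectedComponent.mem_supp_iff, Sym2.eq_swap,
    SimpleGraph.reachable_comm]

lemma partSize_add_partSize [Finite B] {r s : B} (hT : M.coxeterGraph.IsTree)
    (hrs : M.coxeterGraph.Adj r s) : M.partSize r s + M.partSize s r = Nat.card B := by
  classical
  have := Fintype.ofFinite B
  rw [partSize_eq, partSize_swap_eq hT hrs, Finset.card_filter_add_card_filter_not,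
    Nat.card_eq_fintype_card, Finset.card_univ]

/-- The number of braid free words for a finite tree whose edges other than `r s` have label `3`:
besides the empty word, there is one word for each pair of end points and each admissible number of
crossings of the edge `r s`. -/
theorem encard_isBraidFree_of_isTree [Finite B] (hT : M.coxeterGraph.IsTree) {r s : B}
    (hrs : M.coxeterGraph.Adj r s) (h0 : M r s ≠ 0)
    (h3 : ∀ i j, M.coxeterGraph.Adj i j → s(i, j) ≠ s(r, s) → M i j = 3) :
    {ω : List B | M.IsBraidFree ω}.encard =
      ((M r s / 2 * (M.partSize r s ^ 2 + M.partSize s r ^ 2) +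
        (M r s - 1) / 2 * (2 * M.partSize r s * M.partSize s r) + 1 : ℕ) : ℕ∞) := by
  classical
  have := Fintype.ofFinite B
  have hm := three_le_of_adj hrs h0
  set S : Finset (ℕ × B × B) := (Finset.range (M r s - 1) ×ˢ Finset.univ ×ˢ Finset.univ).filter
    fun p => (M.coxeterGraph.OnSide r s p.2.1 ↔ M.coxeterGraph.OnSide r s p.2.2) ↔ Even p.1
    with hS
  have hinj : Set.InjOn (fun p : ℕ × B × B => hT.crossWord r s p.1 p.2.1 p.2.2) S := by
    rintro ⟨j, u, v⟩ hp ⟨k, u', v'⟩ hq h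
    simp only at h
    obtain ⟨l, hl⟩ := hT.exists_crossWord_head r s j u v
    obtain ⟨l', hl'⟩ := hT.exists_crossWord_head r s k u' v'
    have hu : u = u' := by
      rw [hl, hl'] at h
      exact (List.cons.inj h).1
    obtain ⟨l, hl⟩ := hT.exists_crossWord_last r s j u v
    obtain ⟨l', hl'⟩ := hT.exists_crossWord_last r s k u' v'
    have hv : v = v' := by
      rw [hl, hl'] at h
      simpa using (List.append_inj' h rfl).2
    subst hu hv
    simp only [hS, Finset.coe_filter, Set.mem_ofPred_eq] at hp hq
    rw [hT.crossWord_inj hrs hp.2 hq.2 h]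
  have himage : {ω : List B | M.IsBraidFree ω} =
      insert [] ((fun p : ℕ × B × B => hT.crossWord r s p.1 p.2.1 p.2.2) '' S) := by
    ext ω
    simp only [Set.mem_ofPred_eq, Set.mem_insert_iff, Set.mem_image]
    constructor
    · intro hω
      cases ω with
      | nil => exact Or.inl rfl
      | cons u ω =>
        obtain ⟨j, v, hj, hp, he⟩ := hω.exists_eq_crossWord hT hrs h0 h3
        refine Or.inr ⟨(j, u, v), ?_, he.symm⟩
        simp only [hS, Finset.coe_filter, Set.mem_ofPred_eq, Finset.mem_product, Finset.mem_range,
          Finset.mem_univ, and_true]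
        exact ⟨by omega, hp⟩
    · rintro (rfl | ⟨⟨j, u, v⟩, hp, rfl⟩)
      · exact isBraidFree_nil
      · simp only [hS, Finset.coe_filter, Set.mem_ofPred_eq, Finset.mem_product, Finset.mem_range,
          Finset.mem_univ, and_true] at hp
        exact isBraidFree_crossWord hT hrs (by omega) hp.2
  have hnil : [] ∉ (fun p : ℕ × B × B => hT.crossWord r s p.1 p.2.1 p.2.2) '' S := by
    rintro ⟨⟨j, u, v⟩, -, h⟩
    obtain ⟨l, hl⟩ := hT.exists_crossWord_head r s j u v
    simp [hl] at h
  have hcard : S.card = M r s / 2 * (M.partSize r s ^ 2 + M.partSize s r ^ 2) +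
      (M r s - 1) / 2 * (2 * M.partSize r s * M.partSize s r) := by
    have hsame : ∀ j ∈ Finset.range (M r s - 1), (∑ u : B, ∑ v : B,
        if ((M.coxeterGraph.OnSide r s u ↔ M.coxeterGraph.OnSide r s v) ↔ Even j) then 1 else 0) =
        if Even j then M.partSize r s ^ 2 + M.partSize s r ^ 2
          else 2 * M.partSize r s * M.partSize s r := by
      intro j _
      have hu : ∀ u : B, (∑ v : B,
          if ((M.coxeterGraph.OnSide r s u ↔ M.coxeterGraph.OnSide r s v) ↔ Even j) then 1
            else 0) = if (M.coxeterGraph.OnSide r s u ↔ Even j) then M.partSize r s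
              else M.partSize s r := by
        intro u
        rw [← Finset.card_filter, partSize_eq, partSize_swap_eq hT hrs]
        split_ifs with h
        · congr 1; ext v; simp; tauto
        · congr 1; ext v; simp; tauto
      rw [Finset.sum_congr rfl fun u _ => hu u, Finset.sum_ite, Finset.sum_const, Finset.sum_const]
      by_cases hj : Even j
      · simp only [hj, iff_true, if_true, ← partSize_eq, ← partSize_swap_eq hT hrs, smul_eq_mul]
        ring
      · simp only [hj, iff_false, if_false, not_not, ← partSize_eq, ← partSize_swap_eq hT hrs,
          smul_eq_mul]
        ring
    rw [hS, Finset.card_filter, Finset.sum_product]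
    simp only [Finset.sum_product]
    rw [Finset.sum_congr rfl hsame, sum_range_ite_even, show M r s - 1 + 1 = M r s by omega]
  rw [himage, Set.encard_insert_of_notMem hnil, hinj.encard_image, Set.encard_coe_eq_coe_finsetCard,
    hcard]
  push_cast
  rfl

lemma encard_isBraidFree_of_subsingleton [Nonempty B] [Subsingleton B] :
    {ω : List B | M.IsBraidFree ω}.encard = 2 := by
  obtain ⟨b⟩ := ‹Nonempty B›
  have : {ω : List B | M.IsBraidFree ω} = {[], [b]} := by
    ext ω
    simp only [Set.mem_ofPred_eq, Set.mem_insert_iff, Set.mem_singleton_iff]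
    constructor
    · intro h
      match ω, h with
      | [], _ => exact Or.inl rfl
      | [x], _ => exact Or.inr (by rw [Subsingleton.elim x b])
      | x :: y :: _, h => exact absurd (Subsingleton.elim x y) h.adj.ne
    · rintro (rfl | rfl)
      · exact isBraidFree_nil
      · exact isBraidFree_singleton b
  rw [this, Set.encard_pair (by simp)]

end CoxeterMatrix

/-! ### Infinitely many braid free words -/

namespace CoxeterMatrix

variable {B : Type*} {M : CoxeterMatrix B}

/-- A sequence of vertices gives arbitrarily long braid free words if consecutive vertices are
adjacent and it turns back only on edges of label at least `4`, and never twice in a row unless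
the label is infinite (encoded by `0`). -/
lemma encard_isBraidFree_eq_top_of_seq (f : ℕ → B)
    (hadj : ∀ n, M.coxeterGraph.Adj (f n) (f (n + 1)))
    (hback : ∀ n, M (f n) (f (n + 1)) ≠ 0 → f (n + 2) = f n →
      4 ≤ M (f n) (f (n + 1)) ∧ f (n + 3) ≠ f (n + 1)) :
    {ω : List B | M.IsBraidFree ω}.encard = ⊤ := by
  have hbf : ∀ n k, M.IsBraidFree ((List.range' k n).map f) := by
    intro n
    induction n with
    | zero => exact fun _ => isBraidFree_nil
    | succ n ih =>
      intro k
      have ihk := ih (k + 1)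
      rw [List.range'_succ, List.map_cons]
      cases n with
      | zero => exact isBraidFree_singleton _
      | succ n =>
        rw [List.range'_succ, List.map_cons] at ihk ⊢
        refine ihk.cons (hadj k) fun h0 hpre => ?_
        have h3 := three_le_of_adj (hadj k) h0
        obtain ⟨m, hm⟩ : ∃ m, M (f k) (f (k + 1)) = m + 1 + 1 + 1 :=
          ⟨M (f k) (f (k + 1)) - 3, by omega⟩
        rw [hm, altWord_prefix_iff, altWord_prefix_iff, altWord] at hpre
        cases n with
        | zero => simp at hpre
        | succ n =>
          rw [List.range'_succ, List.map_cons, List.cons_prefix_cons] at hpre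
          obtain ⟨h4, h5⟩ := hback k h0 hpre.1.symm
          obtain ⟨m, rfl⟩ : ∃ m', m = m' + 1 := ⟨m - 1, by omega⟩
          have hpre' := hpre.2
          rw [altWord] at hpre'
          cases n with
          | zero => simp at hpre'
          | succ n =>
            rw [List.range'_succ, List.map_cons, List.cons_prefix_cons] at hpre'
            exact h5 hpre'.1.symm
  rw [Set.encard_eq_top_iff]
  refine Set.infinite_of_injective_forall_mem (f := fun n => (List.range' 0 n).map f) ?_
    fun n => hbf n 0
  intro m n h
  simpa using congrArg List.length h

lemma encard_isBraidFree_eq_top_of_infinite [Infinite B] :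
    {ω : List B | M.IsBraidFree ω}.encard = ⊤ := by
  rw [Set.encard_eq_top_iff]
  exact Set.infinite_of_injective_forall_mem (f := fun b => [b]) (fun a b h => by simpa using h)
    isBraidFree_singleton

lemma encard_isBraidFree_eq_top_of_eq_zero {r s : B} (h : M r s = 0) :
    {ω : List B | M.IsBraidFree ω}.encard = ⊤ := by
  have hrs : M.coxeterGraph.Adj r s := by
    refine coxeterGraph_adj_iff.mpr ⟨?_, by omega⟩
    rintro rfl
    simp at h
  refine encard_isBraidFree_eq_top_of_seq (fun n => if Even n then r else s) (fun n => ?_)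
    fun n h0 => ?_
  · by_cases hn : Even n
    · simpa [hn, Nat.even_add_one] using hrs
    · simpa [hn, Nat.even_add_one] using hrs.symm
  · exfalso
    by_cases hn : Even n
    · simp [hn, Nat.even_add_one, h] at h0
    · simp [hn, Nat.even_add_one, M.symmetric s r, h] at h0

lemma add_one_mod_cases (n L : ℕ) (hL : 0 < L) :
    n % L < L ∧ (n % L + 1 < L ∧ (n + 1) % L = n % L + 1 ∨ n % L + 1 = L ∧ (n + 1) % L = 0) := by
  have h := Nat.mod_lt n hL
  refine ⟨h, ?_⟩
  rcases Nat.lt_or_ge (n % L + 1) L with h1 | h1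
  · exact Or.inl ⟨h1, by rw [← Nat.mod_add_mod, Nat.mod_eq_of_lt h1]⟩
  · have : n % L + 1 = L := by omega
    exact Or.inr ⟨this, by rw [← Nat.mod_add_mod, this, Nat.mod_self]⟩

/-- Running around a cycle again and again. -/
lemma encard_isBraidFree_eq_top_of_isCycle {v : B} {c : M.coxeterGraph.Walk v v}
    (hc : c.IsCycle) : {ω : List B | M.IsBraidFree ω}.encard = ⊤ := by
  have hL := hc.three_le_length
  refine encard_isBraidFree_eq_top_of_seq (fun n => c.getVert (n % c.length)) (fun n => ?_)
    fun n _ h => ?_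
  · obtain ⟨h1, ⟨h2, h3⟩ | ⟨h2, h3⟩⟩ := add_one_mod_cases n c.length (by omega)
    · simp only [h3]
      exact c.adj_getVert_succ h1
    · have := c.adj_getVert_succ h1
      rw [h2, c.getVert_length] at this
      simpa only [h3, c.getVert_zero] using this
  · exfalso
    obtain ⟨h1, h2⟩ := add_one_mod_cases n c.length (by omega)
    obtain ⟨h3, h4⟩ := add_one_mod_cases (n + 1) c.length (by omega)
    simp only [add_assoc, Nat.reduceAdd] at h4
    have := hc.getVert_injOn' (by simp only [Set.mem_ofPred_eq]; omega)
      (by simp only [Set.mem_ofPred_eq]; omega) h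
    omega

/-- The position at time `n` of a point that moves back and forth on `0, …, k`. -/
def zigzag (k n : ℕ) : ℕ := if n % (2 * k) ≤ k then n % (2 * k) else 2 * k - n % (2 * k)

/-- Going back and forth on a path whose first and last edge have labels at least `4`. -/
lemma encard_isBraidFree_eq_top_of_isPath {u v : B} {p : M.coxeterGraph.Walk u v} (hp : p.IsPath)
    (hk : 2 ≤ p.length)
    (hfirst : M (p.getVert 0) (p.getVert 1) ≠ 0 → 4 ≤ M (p.getVert 0) (p.getVert 1))
    (hlast : M (p.getVert (p.length - 1)) (p.getVert p.length) ≠ 0 →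
      4 ≤ M (p.getVert (p.length - 1)) (p.getVert p.length)) :
    {ω : List B | M.IsBraidFree ω}.encard = ⊤ := by
  set k := p.length with hkdef
  have hstep : ∀ n, zigzag k n ≤ k ∧
      (zigzag k (n + 1) = zigzag k n + 1 ∨ zigzag k n = zigzag k (n + 1) + 1) := by
    intro n
    have := add_one_mod_cases n (2 * k) (by omega)
    unfold zigzag
    split_ifs <;> omega
  have hturn : ∀ n, zigzag k (n + 2) = zigzag k n →
      (zigzag k n = 1 ∧ zigzag k (n + 1) = 0 ∨
        zigzag k n = k - 1 ∧ zigzag k (n + 1) = k) ∧ zigzag k (n + 3) ≠ zigzag k (n + 1) := by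
    intro n
    have h1 := add_one_mod_cases n (2 * k) (by omega)
    have h2 := add_one_mod_cases (n + 1) (2 * k) (by omega)
    have h3 := add_one_mod_cases (n + 2) (2 * k) (by omega)
    simp only [add_assoc, Nat.reduceAdd] at h2 h3
    unfold zigzag
    split_ifs <;> omega
  have hinj : ∀ m n, p.getVert (zigzag k m) = p.getVert (zigzag k n) → zigzag k m = zigzag k n :=
    fun m n h => hp.getVert_injOn (hstep m).1 (hstep n).1 h
  refine encard_isBraidFree_eq_top_of_seq (fun n => p.getVert (zigzag k n)) (fun n => ?_)
    fun n h0 h => ?_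
  · have h2 := (hstep (n + 1)).1
    obtain ⟨h1, h | h⟩ := hstep n
    · simp only [h]
      exact p.adj_getVert_succ (by omega)
    · simp only [h]
      exact (p.adj_getVert_succ (by omega)).symm
  · obtain ⟨h1, h2⟩ := hturn n (hinj _ _ h)
    refine ⟨?_, fun h' => h2 (hinj _ _ h')⟩
    rcases h1 with ⟨h3, h4⟩ | ⟨h3, h4⟩
    · simp only [h3, h4] at h0 ⊢
      rw [M.symmetric] at h0 ⊢
      exact hfirst h0
    · simp only [h3, h4] at h0 ⊢
      exact hlast h0

/-- Two edges of label at least `4` whose ends `x` and `y` are the closest ones are the first and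
last edge of a path. -/
lemma encard_isBraidFree_eq_top_of_dist_le {x x' y y' : B} (hconn : M.coxeterGraph.Connected)
    (hx : M.coxeterGraph.Adj x x') (hy : M.coxeterGraph.Adj y y')
    (hMx : M x x' ≠ 0 → 4 ≤ M x x') (hMy : M y y' ≠ 0 → 4 ≤ M y y')
    (hne : s(x, x') ≠ s(y, y'))
    (h1 : M.coxeterGraph.dist x y ≤ M.coxeterGraph.dist x' y)
    (h2 : M.coxeterGraph.dist x y ≤ M.coxeterGraph.dist x y')
    (h3 : M.coxeterGraph.dist x y ≤ M.coxeterGraph.dist x' y') :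
    {ω : List B | M.IsBraidFree ω}.encard = ⊤ := by
  classical
  obtain ⟨p, hp, hlen⟩ := (hconn x y).exists_path_of_dist
  have hx' : x' ∉ p.support := by
    intro hmem
    have e1 := congrArg SimpleGraph.Walk.length (p.take_spec hmem)
    rw [SimpleGraph.Walk.length_append] at e1
    have e2 := SimpleGraph.dist_le (p.dropUntil x' hmem)
    have e3 : (p.takeUntil x' hmem).length ≠ 0 := fun h =>
      hx.ne (SimpleGraph.Walk.eq_of_length_eq_zero h)
    omega
  have hy' : y' ∉ p.support := by
    intro hmem
    have e1 := congrArg SimpleGraph.Walk.length (p.take_spec hmem)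
    rw [SimpleGraph.Walk.length_append] at e1
    have e2 := SimpleGraph.dist_le (p.takeUntil y' hmem)
    have e3 : (p.dropUntil y' hmem).length ≠ 0 := fun h =>
      hy.ne (SimpleGraph.Walk.eq_of_length_eq_zero h).symm
    omega
  have hxy' : x' ≠ y' := by
    rintro rfl
    rw [SimpleGraph.dist_self] at h3
    have := (hconn.dist_eq_zero_iff).mp (Nat.le_zero.mp h3)
    exact hne (by rw [this])
  have hq : ((p.concat hy).cons hx.symm).IsPath := by
    refine (hp.concat hy' hy).cons ?_
    rw [SimpleGraph.Walk.support_concat, List.mem_append, List.mem_singleton]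
    tauto
  have hqlen : ((p.concat hy).cons hx.symm).length = p.length + 2 := by
    rw [SimpleGraph.Walk.length_cons, SimpleGraph.Walk.length_concat]
  refine encard_isBraidFree_eq_top_of_isPath hq (by omega) ?_ ?_
  · rw [SimpleGraph.Walk.getVert_zero, SimpleGraph.Walk.getVert_cons_succ,
      SimpleGraph.Walk.getVert_zero, M.symmetric]
    exact hMx
  · rw [SimpleGraph.Walk.getVert_length, hqlen, show p.length + 2 - 1 = p.length + 1 from rfl,
      SimpleGraph.Walk.getVert_cons_succ, SimpleGraph.Walk.concat_eq_append,
      SimpleGraph.Walk.getVert_append]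
    simpa using hMy

lemma encard_isBraidFree_eq_top_of_two_edges (hconn : M.coxeterGraph.Connected) {a a' b b' : B}
    (ha : M.coxeterGraph.Adj a a') (hb : M.coxeterGraph.Adj b b')
    (hMa : M a a' ≠ 0 → 4 ≤ M a a') (hMb : M b b' ≠ 0 → 4 ≤ M b b')
    (hne : s(a, a') ≠ s(b, b')) : {ω : List B | M.IsBraidFree ω}.encard = ⊤ := by
  obtain ⟨⟨i, j⟩, hmin⟩ := Finite.exists_min fun q : Bool × Bool =>
    M.coxeterGraph.dist (bif q.1 then a else a') (bif q.2 then b else b')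
  have hMa' : M a' a ≠ 0 → 4 ≤ M a' a := by rwa [M.symmetric a' a]
  have hMb' : M b' b ≠ 0 → 4 ≤ M b' b := by rwa [M.symmetric b' b]
  have h1 := hmin (!i, j)
  have h2 := hmin (i, !j)
  have h3 := hmin (!i, !j)
  cases i <;> cases j <;>
    simp only [Bool.not_true, Bool.not_false, cond_true, cond_false] at h1 h2 h3
  · exact encard_isBraidFree_eq_top_of_dist_le hconn ha.symm hb.symm hMa' hMb'
      (by rwa [Sym2.eq_swap, Sym2.eq_swap (a := b')]) h1 h2 h3
  · exact encard_isBraidFree_eq_top_of_dist_le hconn ha.symm hb hMa' hMb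
      (by rwa [Sym2.eq_swap]) h1 h2 h3
  · exact encard_isBraidFree_eq_top_of_dist_le hconn ha hb.symm hMa hMb'
      (by rwa [Sym2.eq_swap (a := b')]) h1 h2 h3
  · exact encard_isBraidFree_eq_top_of_dist_le hconn ha hb hMa hMb hne h1 h2 h3

lemma edgeLabel_eq_natCast_iff {r s : B} {m : ℕ} (hm : m ≠ 0) :
    M.edgeLabel r s = (m : ℕ∞) ↔ M r s = m := by
  unfold edgeLabel
  split_ifs with h
  · simp [h, hm.symm]
  · simp

lemma three_lt_edgeLabel_iff {r s : B} : 3 < M.edgeLabel r s ↔ (M r s ≠ 0 → 4 ≤ M r s) := by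
  unfold edgeLabel
  split_ifs with h
  · simpa [h] using ENat.natCast_lt_top 3
  · rw [show (3 : ℕ∞) = ((3 : ℕ) : ℕ∞) from rfl, Nat.cast_lt]
    simp [h]
    omega

end CoxeterMatrix

theorem theorem1 {B W : Type*} [Group W] (M : CoxeterMatrix B) (cs : CoxeterSystem M W)
    (hconn : M.coxeterGraph.Connected) :
    -- simply laced finite trees
    (Finite B → M.coxeterGraph.IsTree → M.SimplyLaced →
      cs.numUniqueReduced = ((Nat.card B ^ 2 + 1 : ℕ) : ℕ∞)) ∧
    -- finite trees without infinite bonds and with exactly one label greater than three,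
    -- which is the label `m` of the edge joining `r` and `s`
    (Finite B → M.coxeterGraph.IsTree → M.NoInfiniteBonds → (∃! e, e ∈ M.heavyEdges) →
      ∀ (r s : B) (m : ℕ), M.coxeterGraph.Adj r s → M.edgeLabel r s = (m : ℕ∞) → 3 < m →
        M.partSize r s + M.partSize s r = Nat.card B ∧
        ∃ U : ℕ, cs.numUniqueReduced = (U : ℕ∞) ∧
          (Even m → (U : ℚ) = 1 / 2 * (m : ℚ) * (Nat.card B : ℚ) ^ 2 + 1
            - 2 * (M.partSize r s : ℚ) * (M.partSize s r : ℚ)) ∧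
          (Odd m → (U : ℚ) = 1 / 2 * ((m : ℚ) - 1) * (Nat.card B : ℚ) ^ 2 + 1)) ∧
    -- every other connected Coxeter graph
    (¬ (Finite B ∧ M.coxeterGraph.IsTree ∧ M.SimplyLaced) →
      ¬ (Finite B ∧ M.coxeterGraph.IsTree ∧ M.NoInfiniteBonds ∧ ∃! e, e ∈ M.heavyEdges) →
      cs.numUniqueReduced = ⊤) := by
  rw [cs.numUniqueReduced_eq_encard_isBraidFree]
  have hlabel : ∀ i j, M.coxeterGraph.Adj i j → M.edgeLabel i j = 3 → M i j = 3 :=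
    fun i j _ h => (CoxeterMatrix.edgeLabel_eq_natCast_iff (m := 3) (by omega)).mp h
  refine ⟨fun hfin hT hsl => ?_, fun hfin hT hnib huniq r s m hrs hm h3 => ?_, fun h1 h2 => ?_⟩
  · rcases subsingleton_or_nontrivial B with hB | hB
    · have := hconn.nonempty
      rw [CoxeterMatrix.encard_isBraidFree_of_subsingleton,
        Nat.card_eq_one_iff_unique.mpr ⟨hB, this⟩]
      rfl
    · obtain ⟨a, b, hab⟩ := exists_pair_ne B
      obtain ⟨x, hax, -⟩ := hT.exists_pathList_eq_cons hab
      have hM := hlabel a x hax (hsl a x hax)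
      rw [CoxeterMatrix.encard_isBraidFree_of_isTree hT hax (by omega)
        fun i j hij _ => hlabel i j hij (hsl i j hij), hM,
        ← CoxeterMatrix.partSize_add_partSize hT hax]
      congr 1
      norm_num
      ring
  · have hM : M r s = m := (CoxeterMatrix.edgeLabel_eq_natCast_iff (by omega)).mp hm
    have hheavy : s(r, s) ∈ M.heavyEdges :=
      ⟨r, s, rfl, hrs, CoxeterMatrix.three_lt_edgeLabel_iff.mpr fun _ => by omega⟩
    have hsize := CoxeterMatrix.partSize_add_partSize hT hrs
    refine ⟨hsize, _, CoxeterMatrix.encard_isBraidFree_of_isTree hT hrs (by omega)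
      fun i j hij hne => ?_, ?_, ?_⟩
    · by_contra h
      refine hne (huniq.unique ⟨i, j, rfl, hij,
        CoxeterMatrix.three_lt_edgeLabel_iff.mpr fun h0 => ?_⟩ hheavy)
      have := CoxeterMatrix.three_le_of_adj hij h0
      omega
    · rintro ⟨k, hk⟩
      rw [hM, ← hsize, show m / 2 = k by omega, show (m - 1) / 2 = k - 1 by omega, hk]
      push_cast [Nat.cast_sub (show 1 ≤ k by omega)]
      ring
    · rintro ⟨k, hk⟩
      rw [hM, ← hsize, show m / 2 = k by omega, show (m - 1) / 2 = k by omega, hk]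
      push_cast
      ring
  · by_cases hfin : Finite B
    swap
    · have := not_finite_iff_infinite.mp hfin
      exact CoxeterMatrix.encard_isBraidFree_eq_top_of_infinite
    by_cases hac : M.coxeterGraph.IsAcyclic
    swap
    · unfold SimpleGraph.IsAcyclic at hac
      push Not at hac
      obtain ⟨v, c, hc⟩ := hac
      exact CoxeterMatrix.encard_isBraidFree_eq_top_of_isCycle hc
    have hT : M.coxeterGraph.IsTree := ⟨hconn, hac⟩
    by_cases hnib : ∃ r s, M r s = 0
    · obtain ⟨r, s, h0⟩ := hnib
      exact CoxeterMatrix.encard_isBraidFree_eq_top_of_eq_zero h0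
    push Not at hnib
    have hsl : ¬ M.SimplyLaced := fun h => h1 ⟨hfin, hT, h⟩
    unfold CoxeterMatrix.SimplyLaced at hsl
    push Not at hsl
    obtain ⟨a, a', ha, hne3⟩ := hsl
    have ha4 : M a a' ≠ 0 → 4 ≤ M a a' := fun h0 => by
      have := CoxeterMatrix.three_le_of_adj ha h0
      have : M a a' ≠ 3 := fun h =>
        hne3 ((CoxeterMatrix.edgeLabel_eq_natCast_iff (m := 3) (by omega)).mpr h)
      omega
    obtain ⟨e, ⟨b, b', rfl, hb, hb4⟩, hne⟩ : ∃ e ∈ M.heavyEdges, e ≠ s(a, a') := by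
      by_contra! hall
      refine h2 ⟨hfin, hT, fun r s _ => ?_,
        ⟨s(a, a'), ⟨a, a', rfl, ha, CoxeterMatrix.three_lt_edgeLabel_iff.mpr ha4⟩, hall⟩⟩
      simp [CoxeterMatrix.edgeLabel, hnib r s]
    exact CoxeterMatrix.encard_isBraidFree_eq_top_of_two_edges hconn ha hb ha4
      (CoxeterMatrix.three_lt_edgeLabel_iff.mp hb4) hne.symm
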